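/- Let $\mathrm{Vec}\,\mathbb R := \mathbb C[x]\,\partial_x$ be the complex Lie algebra of polynomial vector fields on the line, with basis $e_n := x^{n+1}\partial_x$ ($n\ge -1$), and let $\mathfrak U$ be its universal enveloping algebra, with $\mathfrak U_k$ the subspace of elements of degree at most $k$ (the span of all products of at most $k$ elements of $\mathrm{Vec}\,\mathbb R$). For $\lambda\in\mathbb C$, the tensor density module $\mathcal F_\lambda := dx^\lambda\,\mathbb C[x]$ carries the action $$\pi_\lambda(f\partial_x)(dx^\lambda g) := dx^\lambda\,(f g' + \lambda f' g),$$ and its annihilator $\mathrm{Ann}(\mathcal F_\lambda)$ is the kernel of the extension of $\pi_\lambda$ to $\mathfrak U$. For $I\subseteq\mathfrak U$, write $\langle I\rangle$ for the two-sided ideal generated by $I$. In $\mathfrak U$, define $$Q := e_0^2 - e_0 - e_1 e_{-1},\qquad Z := \tfrac12\,(e_1 e_0 - e_2 e_{-1} - e_1),\qquad Y := Q\,(e_0 - \tfrac12) - Z e_{-1},$$ and set $q(\lambda) := \lambda^2-\lambda$ and $y(\lambda) := (\lambda-\tfrac12)\,q(\lambda)$. A two-sided ideal $\mathcal I$ of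 $\mathfrak U$ is said to be generated in degrees $d_1<\dots<d_r$ if $\mathcal I\cap\mathfrak U_{d_1-1}=0$; for $1<s\le r$, $\langle \mathcal I\cap\mathfrak U_{d_{s-1}}\rangle$ contains $\mathcal I\cap\mathfrak U_{d_s-1}$ but not $\mathcal I\cap\mathfrak U_{d_s}$; and $\mathcal I\cap\mathfrak U_{d_r}$ generates $\mathcal I$. **Theorem.** For every $\lambda\in\mathbb C$ with $\lambda\ne 0,1$, $$\mathrm{Ann}(\mathcal F_\lambda) = \big\langle\, Q - q(\lambda),\ Y - y(\lambda)\,\big\rangle,$$ and this ideal is generated in degrees $2$ and $3$; in particular it is not generated in the single degree $2$. -/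

import Mathlib

namespace VecR

open Polynomial

noncomputable section

attribute [local instance 100] LieRing.ofAssociativeRing

/-! ### Universal enveloping algebras, annihilators and degrees -/

section General

variable {L : Type*} [LieRing L] [LieAlgebra ℂ L]

/-- `degLE k` is the subspace of elements of degree at most `k` of the universal enveloping
algebra: the linear span of all products of at most `k` elements of the Lie algebra. -/
def degLE (k : ℕ) : Submodule ℂ (UniversalEnvelopingAlgebra ℂ L) :=
  Submodule.span ℂ {u | ∃ w : List L, w.length ≤ k ∧
    u = (w.map fun x => UniversalEnvelopingAlgebra.ι ℂ x).prod}

/-- The set of elements of degree at most `k` of a two-sided ideal. -/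
def idealDegLE (I : TwoSidedIdeal (UniversalEnvelopingAlgebra ℂ L)) (k : ℕ) :
    Set (UniversalEnvelopingAlgebra ℂ L) :=
  {u | u ∈ I ∧ u ∈ degLE k}

/-- The annihilator of a representation: the kernel of its extension to the universal
enveloping algebra. -/
def annihilator {V : Type*} [AddCommGroup V] [Module ℂ V] (ρ : L →ₗ⁅ℂ⁆ Module.End ℂ V) :
    TwoSidedIdeal (UniversalEnvelopingAlgebra ℂ L) :=
  TwoSidedIdeal.ker (UniversalEnvelopingAlgebra.lift ℂ ρ)

/-- The two-sided ideal `I` is generated in degrees `d 0 < d 1 < ⋯ < d r`: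
it has no nonzero element of degree less than `d 0`; for each `s`, the two-sided ideal generated
by its elements of degree at most `d s` contains all its elements of degree less than `d (s + 1)`,
but not all its elements of degree at most `d (s + 1)`; and its elements of degree at most `d r`
generate it. For `r = 0` this says that `I` is generated in the single degree `d 0`. -/
structure IsGeneratedInDegrees {r : ℕ} (d : Fin (r + 1) → ℕ)
    (I : TwoSidedIdeal (UniversalEnvelopingAlgebra ℂ L)) : Prop where
  strictMono : StrictMono d
  eq_zero_of_lt : ∀ k < d 0, idealDegLE I k = {0}
  subset_of_lt : ∀ s : Fin r, ∀ k < d s.succ, ∀ u ∈ idealDegLE I k,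
    u ∈ TwoSidedIdeal.span (idealDegLE I (d s.castSucc))
  not_subset : ∀ s : Fin r, ¬ ∀ u ∈ idealDegLE I (d s.succ),
    u ∈ TwoSidedIdeal.span (idealDegLE I (d s.castSucc))
  span_eq : TwoSidedIdeal.span (idealDegLE I (d (Fin.last r))) = I

end General

/-! ### Polynomial vector fields on the line and tensor density modules -/

/-- The Lie algebra `ℂ[x] ∂ₓ` of polynomial vector fields on the line, that is, of derivations of
`ℂ[x]`, with the commutator bracket. -/
abbrev Vec : Type := Derivation ℂ ℂ[X] ℂ[X]

/-- The vector field `f ∂ₓ`. -/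
def vectorField (f : ℂ[X]) : Vec := mkDerivation ℂ f

theorem vectorField_apply (f g : ℂ[X]) : vectorField f g = f * derivative g := by
  simp [vectorField, mkDerivation_apply, mul_comm]

/-- Every derivation `D` of `ℂ[x]` is the vector field `D(x) ∂ₓ`. -/
theorem eq_vectorField (D : Vec) : D = vectorField (D X) :=
  Polynomial.derivation_ext (by simp [vectorField_apply])

/-- The monomial vector field `e n = x ^ (n + 1) ∂ₓ`, for `n ≥ -1`. -/
def e (n : ℤ) : Vec := vectorField (X ^ (n + 1).toNat)

/-- The tensor density module of weight `l`: the space `dx^l ℂ[x]`, identified with `ℂ[x]`, on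
which `f ∂ₓ` maps `g` to `f g' + l f' g`. A derivation `D` is `D(x) ∂ₓ`, so it maps `g` to
`D g + l (D x)' g`. -/
def tensorDensity (l : ℂ) : Vec →ₗ⁅ℂ⁆ Module.End ℂ ℂ[X] where
  toFun D :=
    { toFun := fun g => D g + C l * derivative (D X) * g
      map_add' := fun g h => by simp only [map_add]; ring
      map_smul' := fun c g => by simp [smul_eq_C_mul]; ring }
  map_add' D D' := by
    refine LinearMap.ext fun g => ?_
    simp only [LinearMap.coe_mk, AddHom.coe_mk, LinearMap.add_apply, Derivation.add_apply, map_add]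
    ring
  map_smul' c D := by
    refine LinearMap.ext fun g => ?_
    simp [smul_eq_C_mul]
    ring
  map_lie' := by
    intro D D'
    refine LinearMap.ext fun g => ?_
    rw [eq_vectorField D, eq_vectorField D']
    generalize D X = f
    generalize D' X = f'
    simp only [LinearMap.coe_mk, AddHom.coe_mk, Derivation.commutator_apply, vectorField_apply,
      Ring.lie_def, Module.End.mul_apply,
      LinearMap.sub_apply, derivative_X, mul_one, derivative_mul, derivative_add, derivative_sub,
      derivative_C]
    ring

theorem tensorDensity_vectorField (l : ℂ) (f g : ℂ[X]) :
    tensorDensity l (vectorField f) g = f * derivative g + C l * derivative f * g := by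
  simp [tensorDensity, vectorField_apply]

/-! ### The elements `Q`, `Z`, `Y` and the scalars `q`, `y` -/

/-- The universal enveloping algebra of `Vec`. -/
abbrev U : Type := UniversalEnvelopingAlgebra ℂ Vec

/-- The image of `e n` in the universal enveloping algebra. -/
def E (n : ℤ) : U := UniversalEnvelopingAlgebra.ι ℂ (e n)

/-- The Casimir element of the subalgebra spanned by `e (-1)`, `e 0`, `e 1`. -/
def Q : U := E 0 ^ 2 - E 0 - E 1 * E (-1)

def Z : U := (1 / 2 : ℂ) • (E 1 * E 0 - E 2 * E (-1) - E 1)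

def Y : U := Q * (E 0 - algebraMap ℂ U (1 / 2)) - Z * E (-1)

def q (l : ℂ) : ℂ := l ^ 2 - l

def y (l : ℂ) : ℂ := (l - 1 / 2) * q l

end

end VecR

/-! Let `B` be the quotient of `U` by the ideal generated by `Q - q l` and `Y - y l`. Put `d` for
the image of `e (-1)` and `x` for that of `Z / q l`, legitimate because `q l ≠ 0`. Since `[d, Z] =
Q`, these satisfy `[d, x] = 1`, and the relation for `Y` becomes `e 0 = x d + l`. The heart of the
proof (`eq_of_relations`) is that `e 1` and `e 2` must also be the expected operators `x²d + 2lx`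
and `x³d + 3lx²`. A possible error in `e 1` generates elements `D k` resembling powers `d ^ (-k)`.
The Lie relation of weight five puts a nonzero multiple of `D 5` in `x B`, and local nilpotency of
`ad d` then forces `D 1 = 0` (`delta_one_eq_zero`). Hence `B` is spanned by the monomials `x ^ i * d
^ j`. These act on the density module as linearly independent operators, so nothing more is
annihilated.

For the degrees, an element of degree at most two that kills weight `l` acts in weight `m` as
multiplication by a function depending on `m` only through `m² - m`. It therefore kills every weight
with the same value of `q`, whereas `Y` tells such weights apart (`Y_sub_notMem_span`). -/

namespace VecR
open Polynomial
noncomputable section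
attribute [local instance 100] LieRing.ofAssociativeRing
set_option linter.unusedSimpArgs false

/-! ### Local nilpotency of the inner derivation of `d` -/

section AdNilpotent

variable {B : Type*} [Ring B]

/-- The commutator with `d`. -/
def innerDer (d : B) : B →+ B := AddMonoidHom.mulLeft d - AddMonoidHom.mulRight d

theorem innerDer_apply (d b : B) : innerDer d b = d * b - b * d := rfl

theorem innerDer_mul (d a b : B) : innerDer d (a * b) = innerDer d a * b + a * innerDer d b := by
  simp only [innerDer_apply]
  noncomm_ring

theorem iterate_innerDer_mul (d : B) (m n : ℕ) (a b : B) (ha : (innerDer d)^[m] a = 0)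
    (hb : (innerDer d)^[n] b = 0) : (innerDer d)^[m + n] (a * b) = 0 := by
  induction hN : m + n generalizing m n a b with
  | zero =>
    obtain ⟨rfl, rfl⟩ : m = 0 ∧ n = 0 := by omega
    simp_all
  | succ N ih =>
    rw [Function.iterate_succ_apply, innerDer_mul, iterate_map_add]
    have h1 : (innerDer d)^[N] (innerDer d a * b) = 0 := by
      rcases m with _ | m
      · have : a = 0 := ha
        simp [this, iterate_map_zero]
      · exact ih m n _ _ ha hb (by omega)
    have h2 : (innerDer d)^[N] (a * innerDer d b) = 0 := by
      rcases n with _ | n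
      · have : b = 0 := hb
        simp [this, iterate_map_zero]
      · exact ih m n _ _ ha hb (by omega)
    rw [h1, h2, add_zero]

theorem iterate_innerDer_of_le {d : B} {m n : ℕ} (h : m ≤ n) {a : B}
    (ha : (innerDer d)^[m] a = 0) : (innerDer d)^[n] a = 0 := by
  obtain ⟨k, rfl⟩ := Nat.exists_eq_add_of_le' h
  rw [Function.iterate_add_apply, ha, iterate_map_zero]

/-- If `[d, x] = 1` and `d` acts nilpotently on `b`, then `x b` commutes with `d` only if
it vanishes. -/
theorem mul_eq_zero_of_innerDer_eq_zero [Algebra ℂ B] {d x b : B} (hdx : d * x = x * d + 1) {n : ℕ}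
    (hb : (innerDer d)^[n] b = 0) (h : innerDer d (x * b) = 0) : x * b = 0 := by
  have hx : innerDer d x = 1 := by rw [innerDer_apply, hdx]; abel
  -- Obtained by applying `ad d` repeatedly to `b + x [d, b] = 0`.
  have key : ∀ k : ℕ, (k + 1) • (innerDer d)^[k] b + x * (innerDer d)^[k + 1] b = 0 := by
    intro k
    induction k with
    | zero => simpa [innerDer_mul, hx] using h
    | succ k ih =>
      have := congrArg (innerDer d) ih
      rw [map_add, map_nsmul, innerDer_mul, hx, one_mul, map_zero,
        ← Function.iterate_succ_apply' (innerDer d) k,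
        ← Function.iterate_succ_apply' (innerDer d) (k + 1)] at this
      rw [← this, succ_nsmul _ (k + 1)]
      abel
  -- Descent from `ad(d)^n b = 0`; once `k ≥ n`, truncated subtraction makes the step trivial.
  have : ∀ k, (innerDer d)^[n - k] b = 0 := by
    intro k
    induction k with
    | zero => exact hb
    | succ k ih =>
      rcases Nat.lt_or_ge k n with hk | hk
      · have h1 := key (n - (k + 1))
        rw [show n - (k + 1) + 1 = n - k by omega, ih, mul_zero, add_zero,
          ← Nat.cast_smul_eq_nsmul ℂ] at h1
        exact (smul_eq_zero.1 h1).resolve_left (by simp; omega)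
      · rwa [show n - (k + 1) = n - k by omega]
  have h0 := this n
  rw [Nat.sub_self] at h0
  rw [show b = 0 from h0, mul_zero]

end AdNilpotent

/-! ### Derivatives of a delta function -/

section Delta

variable {B : Type*} [Ring B] [Algebra ℂ B]

/-- The elements `D k` behave like the powers `d ^ (-k)` modulo the nonnegative powers. -/
structure IsDeltaSequence (d x : B) (D : ℕ → B) : Prop where
  zero : D 0 = 0
  commute : ∀ k, d * D k = D k * d
  succ_mul : ∀ k, D (k + 1) * d = D k
  mul_x : ∀ k, D k * x = x * D k - (k : ℂ) • D (k + 1)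

/-- Moving a factor `d` out of `D k = D (k + 1) * d` and across gives `D (j + 1) * D k = D j * D (k
+ 1)`, so the left index descends to `D 0 = 0`. -/
theorem IsDeltaSequence.mul_eq_zero {d x : B} {D : ℕ → B} (h : IsDeltaSequence d x D) (j k : ℕ) :
    D j * D k = 0 := by
  induction j generalizing k with
  | zero => rw [h.zero, zero_mul]
  | succ j ih => rw [← h.succ_mul k, ← h.commute, ← mul_assoc, h.succ_mul, ih]

/-- The commutation rule with `x` dictates the recursion, so everything is generated from `w * d`.
The hypothesis `hxw` says that the first step returns `w`, `h0` ends the chain at `D 0 = 0`, and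
commuting with `x` propagates the remaining rules. -/
theorem exists_isDeltaSequence {d x w : B} (hdx : d * x = x * d + 1) (hw : d * w = w * d)
    (hxw : x * w * d - w * x * d = (2 : ℂ) • w) (h0 : w * d * d = 0) :
    ∃ D, IsDeltaSequence d x D ∧ D 1 = w * d ∧ D 2 = w := by
  -- `F k` is the future `D (k + 1)`, so the divisor `k + 1` never vanishes.
  let F : ℕ → B := fun n => Nat.rec (w * d) (fun k b => (-(1 / ((k : ℂ) + 1))) • (b * x - x * b)) n
  have F0 : F 0 = w * d := rfl
  have Fs : ∀ k, F (k + 1) = (-(1 / ((k : ℂ) + 1))) • (F k * x - x * F k) := fun k => rfl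
  have hne : ∀ k : ℕ, (k : ℂ) + 1 ≠ 0 := fun k => Nat.cast_add_one_ne_zero k
  have hdx' : ∀ t, d * (x * t) = x * (d * t) + t := fun t => by
    rw [← mul_assoc, hdx, add_mul, one_mul, mul_assoc]
  have Fd : ∀ k, d * F k = F k * d := by
    intro k
    induction k with
    | zero => rw [F0, ← mul_assoc, hw]
    | succ k ih =>
      have ih' : ∀ t, d * (F k * t) = F k * (d * t) := fun t => by
        rw [← mul_assoc, ih, mul_assoc]
      simp only [Fs, mul_smul_comm, smul_mul_assoc, mul_sub, sub_mul, mul_assoc, hdx', hdx, ih, ih',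
        mul_add, mul_one]
      module
  have Fx : ∀ k, F k * x = x * F k - ((k : ℂ) + 1) • F (k + 1) := by
    intro k
    rw [Fs, smul_smul, show ((k : ℂ) + 1) * (-(1 / ((k : ℂ) + 1))) = -1 by
      have := hne k; field_simp]
    module
  have F1 : F (0 + 1) = w := by
    rw [Fs, F0]
    have : w * (d * x) = w * (x * d) + w := by rw [hdx, mul_add, mul_one]
    simp only [mul_assoc] at hxw ⊢
    rw [this]
    linear_combination (norm := (push_cast; module)) hxw
  have Fsd : ∀ k, F (k + 1) * d = F k := by
    intro k
    induction k with
    | zero => rw [F1, F0]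
    | succ k ih =>
      have h1 : F (k + 1) * x * d = F k * x - F (k + 1) := by
        have : F (k + 1) * (d * x) = F (k + 1) * (x * d) + F (k + 1) := by
          rw [hdx, mul_add, mul_one]
        rw [← mul_assoc, ih, ← mul_assoc] at this
        rw [this, add_sub_cancel_right]
      have h2 := hne (k + 1)
      rw [Fs (k + 1), smul_mul_assoc, sub_mul, h1, mul_assoc, ih, Fx k]
      push_cast at h2 ⊢
      match_scalars <;> field_simp <;> ring
  refine ⟨fun n => Nat.casesOn n 0 F, ⟨rfl, ?_, ?_, ?_⟩, F0, F1⟩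
  · rintro (_ | k)
    · simp
    · exact Fd k
  · rintro (_ | k)
    · exact h0
    · exact Fsd k
  · rintro (_ | k)
    · simp
    · simpa using Fx k

end Delta

/-! ### Rigidity of `e 1` and `e 2` -/

section Relations

variable {B : Type*} [Ring B] [Algebra ℂ B]

/-- If `e1` and `e2` are the standard second order deformations along a delta sequence, then
the relation of weight five between them forces the deformation to be trivial. -/
theorem delta_one_eq_zero {l : ℂ} (h0 : l ≠ 0) (h1 : l ≠ 1) {d x e1 e2 : B}
    (hdx : d * x = x * d + 1) (hnil : ∀ b : B, ∃ n, (innerDer d)^[n] b = 0) {D : ℕ → B}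
    (hD : IsDeltaSequence d x D)
    (he1 : e1 = x * (x * d) + (2 * l) • x - D 1)
    (he2 : e2 = x * (x * (x * d)) + (3 * l) • (x * x) - (3 : ℂ) • (x * D 1) + (2 - l) • D 2)
    (h5 : (6 : ℂ) • ⁅e2, ⁅e1, e2⁆⁆ = ⁅e1, ⁅e1, ⁅e1, e2⁆⁆⁆) : D 1 = 0 := by
  -- `N = x B` is only a right ideal, so words are evaluated from the left modulo `N`: the first
  -- letter produces some `D k`, and each further letter `e1` or `e2` raises the index by its
  -- weight, up to a scalar.
  let N : Submodule ℂ B := LinearMap.range (LinearMap.mulLeft ℂ x)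
  let p : B →ₗ[ℂ] B ⧸ N := N.mkQ
  have px : ∀ t, p (x * t) = 0 := fun t =>
    (Submodule.Quotient.mk_eq_zero N).2 ⟨t, rfl⟩
  have Dx : ∀ k t, D k * (x * t) = x * (D k * t) - (k : ℂ) • (D (k + 1) * t) := fun k t => by
    rw [← mul_assoc, hD.mul_x, sub_mul, smul_mul_assoc, mul_assoc]
  have Dd : ∀ k t, D (k + 1) * (d * t) = D k * t := fun k t => by
    rw [← mul_assoc, hD.succ_mul]
  have DD : ∀ j k t, D j * (D k * t) = 0 := fun j k t => by
    rw [← mul_assoc, hD.mul_eq_zero, zero_mul]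
  have pe1 : ∀ t, p (e1 * t) = -p (D 1 * t) := fun t => by
    rw [he1, sub_mul, add_mul, smul_mul_assoc, mul_assoc, map_sub, map_add, map_smul, px, px]
    simp
  have pe2 : ∀ t, p (e2 * t) = (2 - l) • p (D 2 * t) := fun t => by
    simp only [he2, sub_mul, add_mul, smul_mul_assoc, mul_assoc, map_sub, map_add, map_smul, px]
    simp
  have pD1 : ∀ k t, p (D k * (e1 * t)) =
      ((k : ℂ) * (k + 1) - 2 * l * k) • p (D (k + 1) * t) := fun k t => by
    simp only [he1, sub_mul, add_mul, mul_add, mul_sub, smul_mul_assoc, mul_smul_comm, mul_assoc,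
      map_sub, map_add, map_smul, px, Dx, Dd, DD, map_zero]
    push_cast
    module
  have pD2 : ∀ k t, p (D k * (e2 * t)) =
      (-(k : ℂ) * (k + 1) * (k + 2) + 3 * l * k * (k + 1)) • p (D (k + 2) * t) := fun k t => by
    simp only [he2, sub_mul, add_mul, mul_add, mul_sub, smul_mul_assoc, mul_smul_comm, mul_assoc,
      map_sub, map_add, map_smul, px, Dx, Dd, DD, map_zero]
    push_cast
    module
  have h5' := congrArg p (congrArg (· * (1 : B)) h5)
  simp only [Ring.lie_def, mul_sub, sub_mul, smul_sub, map_sub, map_smul, smul_mul_assoc,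
    mul_smul_comm, mul_assoc, pe1, pe2, pD1, pD2, map_neg] at h5'
  -- Every word in the relation has weight five, so both sides are multiples of `D 5`; this is their
  -- difference.
  have h6 : (192 * (l ^ 2 - l) ^ 2) • p (D 5 * 1) = 0 := by
    rw [← sub_eq_zero] at h5'
    rw [← h5']
    push_cast
    norm_num
    module
  have hq : (192 * (l ^ 2 - l) ^ 2) ≠ 0 := by
    have : l ^ 2 - l = l * (l - 1) := by ring
    rw [this]
    simp [h0, sub_ne_zero.2 h1]
  have h7 := (smul_eq_zero.1 h6).resolve_left hq
  obtain ⟨t, ht⟩ := (Submodule.Quotient.mk_eq_zero N).1 h7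
  rw [mul_one, LinearMap.mulLeft_apply] at ht
  -- `D 1 = D 5 * d⁴`, and `D 5` lies in `x B`.
  have h8 : D 1 = x * (t * d * d * d * d) := by
    simp only [← mul_assoc, ht, hD.succ_mul]
  rw [h8]
  obtain ⟨n, hn⟩ := hnil (t * d * d * d * d)
  refine mul_eq_zero_of_innerDer_eq_zero hdx hn ?_
  rw [← h8, innerDer_apply, hD.commute, sub_self]

/-- The relations of the universal enveloping algebra modulo `Q - q l` and `Y - y l` determine
the vector fields `e 1` and `e 2` in terms of `x = Z / q l` and `d = e (-1)`. -/
theorem eq_of_relations {l : ℂ} (h0 : l ≠ 0) (h1 : l ≠ 1) {d x e0 e1 e2 : B}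
    (hnil : ∀ b : B, ∃ n, (innerDer d)^[n] b = 0)
    (hdx : d * x = x * d + 1) (he0 : e0 = x * d + l • (1 : B))
    (hd1 : d * e1 = e1 * d + (2 : ℂ) • e0) (hd2 : d * e2 = e2 * d + (3 : ℂ) • e1)
    (h02 : e0 * e2 = e2 * e0 + (2 : ℂ) • e2)
    (hQ : e0 * e0 - e0 - e1 * d = (l ^ 2 - l) • (1 : B))
    (hZ : e1 * e0 - e2 * d - e1 = (2 * (l ^ 2 - l)) • x)
    (hY : e1 = (2 : ℂ) • (x * e0) - (e1 * x - x * e1) * d)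
    (h5 : (6 : ℂ) • ⁅e2, ⁅e1, e2⁆⁆ = ⁅e1, ⁅e1, ⁅e1, e2⁆⁆⁆) :
    e1 = x * (x * d) + (2 * l) • x ∧ e2 = x * (x * (x * d)) + (3 * l) • (x * x) := by
  have hdx' : ∀ t, d * (x * t) = x * (d * t) + t := fun t => by
    rw [← mul_assoc, hdx, add_mul, one_mul, mul_assoc]
  subst he0
  -- The expected `e1` satisfies `[e1, x] = x²`; `w` measures the failure.
  obtain ⟨w, hw⟩ : ∃ w, w = e1 * x - x * e1 - x * x := ⟨_, rfl⟩
  have e1w : e1 = x * (x * d) + (2 * l) • x - w * d := by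
    rw [hw]
    linear_combination (norm := skip) hY
    simp only [mul_add, add_mul, mul_sub, sub_mul, mul_assoc, smul_mul_assoc, mul_smul_comm,
      mul_one, one_mul, smul_add, smul_sub]
    module
  have dw : d * w = w * d := by
    have hd1' : ∀ t, d * (e1 * t) = e1 * (d * t) + (2 : ℂ) • (x * (d * t)) + (2 * l) • t :=
      fun t => by
        rw [← mul_assoc, hd1]
        simp only [add_mul, mul_assoc, smul_mul_assoc, one_mul, smul_add]
        module
    rw [hw]
    simp only [mul_add, add_mul, mul_sub, sub_mul, mul_assoc, smul_mul_assoc, mul_smul_comm,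
      mul_one, one_mul, smul_add, hdx, hdx', hd1, hd1']
    module
  have xw : x * w * d - w * x * d = (2 : ℂ) • w := by
    have G : e1 * (x * d) - x * (e1 * d) - (2 : ℂ) • (x * (x * d)) - (2 * l) • x + e1 = 0 := by
      linear_combination (norm := skip) hY
      simp only [mul_add, add_mul, mul_sub, sub_mul, mul_assoc, smul_mul_assoc, mul_smul_comm,
        mul_one, one_mul, smul_add, smul_sub]
      module
    -- The identity for `w` is the commutator of `x` with `G`.
    have Gl := congrArg (x * ·) G
    have Gr := congrArg (· * x) G
    simp only [mul_zero, zero_mul] at Gl Gr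
    rw [hw]
    linear_combination (norm := skip) Gl - Gr
    simp only [mul_add, add_mul, mul_sub, sub_mul, mul_assoc, smul_mul_assoc, mul_smul_comm,
      mul_one, one_mul, smul_add, smul_sub, hdx, hdx']
    module
  have wdd : w * d * d = 0 := by
    rw [e1w] at hQ
    linear_combination (norm := skip) hQ
    simp only [mul_add, add_mul, mul_sub, sub_mul, mul_assoc, smul_mul_assoc, mul_smul_comm,
      mul_one, one_mul, smul_add, smul_sub, hdx, hdx']
    module
  obtain ⟨D, hD, D1, D2⟩ := exists_isDeltaSequence hdx dw xw wdd
  have e1D : e1 = x * (x * d) + (2 * l) • x - D 1 := by rw [D1, ← e1w]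
  have Dd2 : D 2 * d = D 1 := hD.succ_mul 1
  have Dd1 : D 1 * d = 0 := by rw [hD.succ_mul 0, hD.zero]
  have Dx1 : D 1 * x = x * D 1 - D 2 := by simpa using hD.mul_x 1
  have Dx1' : ∀ t, D 1 * (x * t) = x * (D 1 * t) - D 2 * t := fun t => by
    rw [← mul_assoc, Dx1, sub_mul, mul_assoc]
  have dD : ∀ k, d * D k = D k * d := hD.commute
  have dD' : ∀ k t, d * (D k * t) = D k * (d * t) := fun k t => by
    rw [← mul_assoc, dD, mul_assoc]
  -- `hZ` prescribes `e2 * d`. The terms subtracted here come from dividing by `d` on the right, so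
  -- the remainder satisfies `c * d = 0`.
  obtain ⟨c, hc⟩ : ∃ c, c = e2 - x * (x * (x * d)) - (3 * l) • (x * x) + (3 : ℂ) • (x * D 1)
    - (2 - l) • D 2 := ⟨_, rfl⟩
  have e2c : e2 = x * (x * (x * d)) + (3 * l) • (x * x) - (3 : ℂ) • (x * D 1) + (2 - l) • D 2
    + c := by rw [hc]; module
  have cd : c * d = 0 := by
    rw [e2c, e1D] at hZ
    linear_combination (norm := skip) -hZ
    simp only [mul_add, add_mul, mul_sub, sub_mul, mul_assoc, smul_mul_assoc, mul_smul_comm,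
      mul_one, one_mul, smul_add, smul_sub, hdx, hdx', Dd1, Dd2, Dx1, Dx1', mul_zero]
    module
  -- As `d * c = c * d = 0`, the commutator of `e0` with `c` is `c`, while the weight of `e2`
  -- requires `2c`.
  have c0 : c = 0 := by
    have hdc : d * c = c * d := by
      rw [e1D, e2c] at hd2
      linear_combination (norm := skip) hd2
      simp only [mul_add, add_mul, mul_sub, sub_mul, mul_assoc, smul_mul_assoc, mul_smul_comm,
        mul_one, one_mul, smul_add, smul_sub, hdx, hdx', dD, dD']
      module
    have Dx2 : D 2 * (x * d) = x * D 1 - (2 : ℂ) • D 2 := by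
      have := congrArg (· * d) (hD.mul_x 2)
      simp only [sub_mul, smul_mul_assoc, mul_assoc, Dd2, hD.succ_mul] at this
      simpa using this
    have hcx : c * (x * d) = -c := by
      have : c * (d * x) = c * (x * d) + c := by rw [hdx, mul_add, mul_one]
      rw [← mul_assoc, cd, zero_mul] at this
      exact (neg_eq_of_add_eq_zero_left this.symm).symm
    rw [e2c] at h02
    linear_combination (norm := skip) -h02
    simp only [mul_add, add_mul, mul_sub, sub_mul, mul_assoc, smul_mul_assoc, mul_smul_comm,
      mul_one, one_mul, smul_add, smul_sub, hdx, hdx', dD, dD', Dd1, Dd2, Dx1, Dx1', Dx2, hcx,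
      hdc, cd, mul_zero]
    module
  rw [c0, add_zero] at e2c
  have D10 : D 1 = 0 := delta_one_eq_zero h0 h1 hdx hnil hD e1D e2c h5
  have D20 : D 2 = 0 := by
    have := Dx1
    simpa [D10] using this
  rw [D10] at e1D e2c
  rw [D20] at e2c
  exact ⟨by simpa using e1D, by simpa using e2c⟩

end Relations

/-! ### Generators of the universal enveloping algebra -/

theorem enveloping_induction {L : Type*} [LieRing L] [LieAlgebra ℂ L]
    {p : UniversalEnvelopingAlgebra ℂ L → Prop}
    (algebraMap : ∀ c, p (algebraMap ℂ _ c)) (ι : ∀ D, p (UniversalEnvelopingAlgebra.ι ℂ D))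
    (mul : ∀ a b, p a → p b → p (a * b)) (add : ∀ a b, p a → p b → p (a + b))
    (u : UniversalEnvelopingAlgebra ℂ L) : p u := by
  obtain ⟨t, rfl⟩ : ∃ t, UniversalEnvelopingAlgebra.mkAlgHom ℂ L t = u :=
    RingCon.mkₐ_surjective (α := ℂ) _ u
  induction t using TensorAlgebra.induction with
  | algebraMap c => rw [AlgHom.commutes]; exact algebraMap c
  | ι D => rw [← UniversalEnvelopingAlgebra.ι_apply]; exact ι D
  | mul a b ha hb => rw [map_mul]; exact mul _ _ ha hb
  | add a b ha hb => rw [map_add]; exact add _ _ ha hb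

/-- The linear map `f ↦ f ∂ₓ`. -/
def vectorFieldₗ : ℂ[X] →ₗ[ℂ] Vec := (mkDerivation ℂ : ℂ[X] →ₗ[ℂ] Vec)

theorem vectorFieldₗ_apply (f : ℂ[X]) : vectorFieldₗ f = vectorField f := rfl

theorem lie_vectorField (f g : ℂ[X]) :
    ⁅vectorField f, vectorField g⁆ = vectorField (f * derivative g - g * derivative f) := by
  refine Polynomial.derivation_ext ?_
  rw [Derivation.commutator_apply]
  simp [vectorField_apply]

theorem lie_vectorField_pow_succ (m n : ℕ) :
    ⁅vectorField (X ^ (m + 1)), vectorField (X ^ n)⁆ =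
      ((n : ℂ) - m - 1) • vectorField (X ^ (m + n)) := by
  rw [lie_vectorField, ← vectorFieldₗ_apply, ← vectorFieldₗ_apply, ← map_smul, smul_eq_C_mul]
  congr 1
  rcases n with _ | n
  · simp
    ring
  · simp
    ring

/-- The image of `X ^ n ∂ₓ` in the universal enveloping algebra. -/
def F (n : ℕ) : U := UniversalEnvelopingAlgebra.ι ℂ (vectorField (X ^ n))

theorem F_mul_F (m n : ℕ) :
    F (m + 1) * F n = F n * F (m + 1) + ((n : ℂ) - m - 1) • F (m + n) := by
  have := congrArg (UniversalEnvelopingAlgebra.ι ℂ) (lie_vectorField_pow_succ m n)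
  rw [LieHom.map_lie, map_smul, Ring.lie_def] at this
  exact sub_eq_iff_eq_add'.1 this

theorem F_zero_mul_F (n : ℕ) : F 0 * F (n + 1) = F (n + 1) * F 0 + ((n : ℂ) + 1) • F n := by
  have := F_mul_F n 0
  rw [this]
  simp only [Nat.cast_zero, add_zero]
  module

theorem E_neg_one : E (-1) = F 0 := rfl
theorem E_zero : E 0 = F 1 := rfl
theorem E_one : E 1 = F 2 := rfl
theorem E_two : E 2 = F 3 := rfl

theorem vectorField_induction {p : Vec → Prop} (pow : ∀ n, p (vectorField (X ^ n)))
    (add : ∀ a b, p a → p b → p (a + b)) (smul : ∀ (c : ℂ) a, p a → p (c • a)) (D : Vec) :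
    p D := by
  rw [eq_vectorField D]
  induction D X using Polynomial.induction_on' with
  | add f g hf hg =>
    rw [← vectorFieldₗ_apply, map_add]
    exact add _ _ hf hg
  | monomial n c =>
    rw [← vectorFieldₗ_apply, ← C_mul_X_pow_eq_monomial, ← smul_eq_C_mul, map_smul]
    exact smul _ _ (pow n)

/-- An element of the enveloping algebra is built from the vector fields `X ^ n ∂ₓ`. -/
theorem U_induction {p : U → Prop} (algebraMap : ∀ c, p (algebraMap ℂ U c)) (F : ∀ n, p (F n))
    (mul : ∀ a b, p a → p b → p (a * b)) (add : ∀ a b, p a → p b → p (a + b)) (u : U) : p u := by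
  refine enveloping_induction algebraMap (fun D => ?_) mul add u
  refine vectorField_induction (p := fun D => p (UniversalEnvelopingAlgebra.ι ℂ D)) F ?_ ?_ D
  · intro a b ha hb
    rw [map_add]
    exact add _ _ ha hb
  · intro c a ha
    rw [map_smul, Algebra.smul_def]
    exact mul _ _ (algebraMap c) ha

theorem exists_iterate_innerDer_F_zero (u : U) : ∃ n, (innerDer (F 0))^[n] u = 0 := by
  induction u using U_induction with
  | algebraMap c => exact ⟨1, by simp [innerDer_apply, Algebra.commutes]⟩
  | F n =>
    refine ⟨n + 1, ?_⟩
    induction n with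
    | zero => simp [innerDer_apply]
    | succ n ih =>
      have h : innerDer (F 0) (F (n + 1)) = ((n + 1 : ℕ) : U) * F n := by
        rw [innerDer_apply, F_zero_mul_F, add_sub_cancel_left, Algebra.smul_def]
        simp
      rw [Function.iterate_succ_apply, h, ← nsmul_eq_mul, iterate_map_nsmul, ih, smul_zero]
  | mul a b ha hb =>
    obtain ⟨m, hm⟩ := ha
    obtain ⟨n, hn⟩ := hb
    exact ⟨m + n, iterate_innerDer_mul _ m n a b hm hn⟩
  | add a b ha hb =>
    obtain ⟨m, hm⟩ := ha
    obtain ⟨n, hn⟩ := hb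
    exact ⟨m + n, by rw [iterate_map_add, iterate_innerDer_of_le (by omega) hm,
      iterate_innerDer_of_le (by omega) hn, add_zero]⟩

/-! ### The quotient in which `Q` and `Y` are scalars -/

section Quotient

variable {B : Type*} [Ring B] [Algebra ℂ B]

/-- The span of ordered monomials contains `1` and is stable under left multiplication by `x` and by
`d`. -/
theorem mem_span_pow_mul_pow {d x b : B} (hdx : d * x = x * d + 1)
    (hb : b ∈ Algebra.adjoin ℂ {x, d}) :
    b ∈ Submodule.span ℂ (Set.range fun i : ℕ × ℕ => x ^ i.1 * d ^ i.2) := by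
  set T := Submodule.span ℂ (Set.range fun i : ℕ × ℕ => x ^ i.1 * d ^ i.2)
  have hT : ∀ i j, x ^ i * d ^ j ∈ T := fun i j => Submodule.subset_span ⟨(i, j), rfl⟩
  have dxn : ∀ n : ℕ, d * x ^ n = x ^ n * d + (n : ℂ) • x ^ (n - 1) := by
    intro n
    induction n with
    | zero => simp
    | succ n ih =>
      rw [pow_succ, ← mul_assoc, ih, add_mul, mul_assoc, hdx, smul_mul_assoc]
      rcases n with _ | n
      · simp
      · simp only [Nat.add_sub_cancel, ← pow_succ, mul_add, mul_one, ← mul_assoc]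
        push_cast
        module
  have hx : ∀ t ∈ T, x * t ∈ T := by
    intro t ht
    induction ht using Submodule.span_induction with
    | mem t ht =>
      obtain ⟨⟨i, j⟩, rfl⟩ := ht
      simpa [pow_succ', mul_assoc] using hT (i + 1) j
    | zero => simp
    | add a b _ _ ha hb => rw [mul_add]; exact add_mem ha hb
    | smul c a _ ha => rw [mul_smul_comm]; exact T.smul_mem c ha
  have hd : ∀ t ∈ T, d * t ∈ T := by
    intro t ht
    induction ht using Submodule.span_induction with
    | mem t ht =>
      obtain ⟨⟨i, j⟩, rfl⟩ := ht
      rw [← mul_assoc, dxn, add_mul, mul_assoc, ← pow_succ', smul_mul_assoc]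
      exact add_mem (hT _ _) (T.smul_mem _ (hT _ _))
    | zero => simp
    | add a b _ _ ha hb => rw [mul_add]; exact add_mem ha hb
    | smul c a _ ha => rw [mul_smul_comm]; exact T.smul_mem c ha
  have key : ∀ t ∈ T, b * t ∈ T := by
    induction hb using Algebra.adjoin_induction with
    | mem a ha =>
      rcases ha with rfl | rfl
      · exact hx
      · exact hd
    | algebraMap c => exact fun t ht => by rw [← Algebra.smul_def]; exact T.smul_mem c ht
    | add a b _ _ ha hb => exact fun t ht => by rw [add_mul]; exact add_mem (ha t ht) (hb t ht)
    | mul a b _ _ ha hb => exact fun t ht => by rw [mul_assoc]; exact ha _ (hb t ht)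
  simpa using key 1 (by simpa using hT 0 0)

/-- If `Q` and `Y` act in a quotient of the enveloping algebra as they do on the tensor density
module of weight `l`, then the quotient is spanned by the monomials in `Z / q l` and `e (-1)`. -/
theorem mem_span_of_Q_eq_of_Y_eq {l : ℂ} (h0 : l ≠ 0) (h1 : l ≠ 1) {φ : U →ₐ[ℂ] B}
    (hφ : Function.Surjective φ) (hQ : φ Q = algebraMap ℂ B (q l))
    (hY : φ Y = algebraMap ℂ B (y l)) (b : B) :
    b ∈ Submodule.span ℂ
      (Set.range fun i : ℕ × ℕ => φ ((q l)⁻¹ • Z) ^ i.1 * φ (F 0) ^ i.2) := by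
  have hq : q l ≠ 0 := by
    rw [q, show l ^ 2 - l = l * (l - 1) by ring]
    exact mul_ne_zero h0 (sub_ne_zero.2 h1)
  set x := φ ((q l)⁻¹ • Z) with hx
  set d := φ (F 0) with hd
  have hZx : φ Z = q l • x := by rw [hx, map_smul, smul_smul, mul_inv_cancel₀ hq, one_smul]
  have rel : ∀ m n : ℕ, φ (F (m + 1)) * φ (F n) =
      φ (F n) * φ (F (m + 1)) + ((n : ℂ) - m - 1) • φ (F (m + n)) := fun m n => by
    rw [← map_mul, F_mul_F, map_add, map_mul, map_smul]
  have rel0 : ∀ n : ℕ, d * φ (F (n + 1)) = φ (F (n + 1)) * d + ((n : ℂ) + 1) • φ (F n) :=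
    fun n => by rw [hd, ← map_mul, F_zero_mul_F, map_add, map_mul, map_smul]
  have Qrel : φ (F 1) * φ (F 1) - φ (F 1) - φ (F 2) * d = q l • (1 : B) := by
    rw [← Algebra.algebraMap_eq_smul_one, ← hQ, Q, E_zero, E_one, E_neg_one]
    simp [pow_two, hd]
  have Zrel : φ (F 2) * φ (F 1) - φ (F 3) * d - φ (F 2) = (2 * q l) • x := by
    rw [mul_smul, ← hZx, Z, E_zero, E_one, E_neg_one, E_two, map_smul, smul_smul]
    simp [hd]
  have d1 : d * φ (F 1) = φ (F 1) * d + d := by simpa [hd] using rel0 0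
  have d2 : d * φ (F 2) = φ (F 2) * d + (2 : ℂ) • φ (F 1) := by
    have := rel0 1; norm_num at this; exact this
  have d3 : d * φ (F 3) = φ (F 3) * d + (3 : ℂ) • φ (F 2) := by
    have := rel0 2; norm_num at this; exact this
  have r13 : φ (F 1) * φ (F 3) = φ (F 3) * φ (F 1) + (2 : ℂ) • φ (F 3) := by
    have := rel 0 3; norm_num at this; exact this
  have hdx : d * x = x * d + 1 := by
    -- This is `[d, Z] = Q`, scaled to clear the denominators of `Z` and `x`.
    have h2 : (2 * q l) • (d * x - x * d - 1) = 0 := by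
      have e : ∀ t, d * (φ (F 1) * t) = φ (F 1) * (d * t) + d * t := fun t => by
        rw [← mul_assoc, d1, add_mul, mul_assoc]
      have e' : ∀ t, d * (φ (F 2) * t) = φ (F 2) * (d * t) + (2 : ℂ) • (φ (F 1) * t) := fun t => by
        rw [← mul_assoc, d2, add_mul, mul_assoc, smul_mul_assoc]
      have e'' : ∀ t, d * (φ (F 3) * t) = φ (F 3) * (d * t) + (3 : ℂ) • (φ (F 2) * t) :=
        fun t => by rw [← mul_assoc, d3, add_mul, mul_assoc, smul_mul_assoc]
      have : (2 * q l) • (d * x - x * d - 1) =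
          d * ((2 * q l) • x) - (2 * q l) • x * d - (2 : ℂ) • q l • (1 : B) := by
        rw [mul_smul_comm, smul_mul_assoc]
        module
      rw [this, ← Zrel, ← Qrel]
      simp only [mul_add, add_mul, mul_sub, sub_mul, mul_assoc, smul_mul_assoc, mul_smul_comm,
        mul_one, one_mul, smul_add, smul_sub, d1, d2, d3, e, e', e'']
      module
    have := (smul_eq_zero.1 h2).resolve_left (mul_ne_zero two_ne_zero hq)
    rw [← sub_eq_zero, ← this]
    abel
  have Yrel : φ (F 1) = x * d + l • (1 : B) := by
    have : q l • (φ (F 1) - x * d - l • (1 : B)) = 0 := by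
      have := hY
      rw [Y, map_sub, map_mul, map_mul, hQ, hZx, E_zero, E_neg_one, map_sub, AlgHom.commutes,
        ← hd, Algebra.algebraMap_eq_smul_one, Algebra.algebraMap_eq_smul_one,
        Algebra.algebraMap_eq_smul_one, y] at this
      rw [← sub_eq_zero] at this
      rw [← this]
      simp only [mul_sub, smul_mul_assoc, one_mul, smul_sub]
      module
    have := (smul_eq_zero.1 this).resolve_left hq
    rw [← sub_eq_zero, ← this]
    abel
  have hnil : ∀ b : B, ∃ n, (innerDer d)^[n] b = 0 := by
    intro b
    obtain ⟨u, rfl⟩ := hφ b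
    obtain ⟨n, hn⟩ := exists_iterate_innerDer_F_zero u
    refine ⟨n, ?_⟩
    have : ∀ k, (innerDer d)^[k] (φ u) = φ ((innerDer (F 0))^[k] u) := by
      intro k
      induction k with
      | zero => rfl
      | succ k ih =>
        rw [Function.iterate_succ_apply', ih, Function.iterate_succ_apply', innerDer_apply,
          innerDer_apply, map_sub, map_mul, map_mul]
    rw [this, hn, map_zero]
  -- This is `[e 1, e 0] = -e 1` with `x d + l` substituted for `e 0`.
  have hY' : φ (F 2) = (2 : ℂ) • (x * φ (F 1)) - (φ (F 2) * x - x * φ (F 2)) * d := by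
    have r21 : φ (F 2) * φ (F 1) = φ (F 1) * φ (F 2) - φ (F 2) := by
      have := rel 1 1
      norm_num at this
      rw [this]; abel
    rw [Yrel, mul_add, add_mul] at r21
    simp only [mul_smul_comm, smul_mul_assoc, mul_one, one_mul, mul_assoc, d2] at r21
    rw [mul_add] at r21
    rw [sub_mul, mul_assoc, mul_assoc]
    rw [mul_smul_comm] at r21
    linear_combination (norm := module) r21
  -- Both sides are `6 • φ (F 6)`, the image of `6 e 5`.
  have h5 : (6 : ℂ) • ⁅φ (F 3), ⁅φ (F 2), φ (F 3)⁆⁆ =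
      ⁅φ (F 2), ⁅φ (F 2), ⁅φ (F 2), φ (F 3)⁆⁆⁆ := by
    have lieF : ∀ m n : ℕ, ⁅φ (F (m + 1)), φ (F n)⁆ = ((n : ℂ) - m - 1) • φ (F (m + n)) :=
      fun m n => by rw [Ring.lie_def, rel, add_sub_cancel_left]
    have l1 := lieF 1 3
    have l2 := lieF 1 4
    have l3 := lieF 1 5
    have l4 := lieF 2 4
    norm_num at l1 l2 l3 l4
    rw [l1, l4, l2, lie_smul, l3, smul_smul]
    norm_num
  obtain ⟨e1, e2⟩ := eq_of_relations h0 h1 hnil hdx Yrel d2 d3 r13 Qrel Zrel hY' h5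
  obtain ⟨u, rfl⟩ := hφ b
  refine mem_span_pow_mul_pow hdx ?_
  set S := Algebra.adjoin ℂ {x, d}
  have xS : x ∈ S := Algebra.subset_adjoin (by simp)
  have dS : d ∈ S := Algebra.subset_adjoin (by simp)
  have F2S : φ (F 2) ∈ S := by
    rw [e1]
    exact add_mem (mul_mem xS (mul_mem xS dS)) (S.smul_mem xS _)
  have F3S : φ (F 3) ∈ S := by
    rw [e2]
    exact add_mem (mul_mem xS (mul_mem xS (mul_mem xS dS))) (S.smul_mem (mul_mem xS xS) _)
  -- Since `F k` is `E (k - 1)`, brackets with `e 1` produce every higher field from `e 2`.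
  have FS : ∀ n, φ (F (n + 3)) ∈ S := by
    intro n
    induction n with
    | zero => exact F3S
    | succ n ih =>
      have := rel 1 (n + 3)
      have h : φ (F (n + 1 + 3)) =
          ((n : ℂ) + 1)⁻¹ • (φ (F 2) * φ (F (n + 3)) - φ (F (n + 3)) * φ (F 2)) := by
        rw [this, add_sub_cancel_left, smul_smul, show 1 + (n + 3) = n + 1 + 3 by ring]
        rw [show ((n : ℂ) + 1)⁻¹ * (((n + 3 : ℕ) : ℂ) - (1 : ℕ) - 1) = 1 by
          have := Nat.cast_add_one_ne_zero (R := ℂ) n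
          push_cast
          field_simp
          ring, one_smul]
      rw [h]
      exact S.smul_mem (sub_mem (mul_mem F2S ih) (mul_mem ih F2S)) _
  induction u using U_induction with
  | algebraMap c => rw [AlgHom.commutes]; exact S.algebraMap_mem c
  | F n =>
    match n with
    | 0 => exact dS
    | 1 => rw [Yrel]; exact add_mem (mul_mem xS dS) (S.smul_mem (one_mem _) _)
    | 2 => exact F2S
    | n + 3 => exact FS n
  | mul a b ha hb => rw [map_mul]; exact mul_mem ha hb
  | add a b ha hb => rw [map_add]; exact add_mem ha hb

end Quotient

/-! ### Tensor densities with coefficients in a commutative algebra -/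

section Density

variable (R : Type) [CommRing R] [Algebra ℂ R]

/-- The coefficient of a vector field, with coefficients extended to `R`. -/
def coeffMap : ℂ[X] →ₐ[ℂ] R[X] := mapAlgHom (Algebra.ofId ℂ R)

variable {R}

theorem coeffMap_self (f : ℂ[X]) : coeffMap ℂ f = f := by
  change map (algebraMap ℂ ℂ) f = f
  rw [Algebra.algebraMap_self, Polynomial.map_id]

theorem coeffMap_X : coeffMap R X = X := by simp [coeffMap]

theorem coeffMap_C (c : ℂ) : coeffMap R (C c) = C (algebraMap ℂ R c) := by
  simp [coeffMap, Algebra.ofId_apply]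

theorem derivative_coeffMap (f : ℂ[X]) :
    derivative (coeffMap R f) = coeffMap R (derivative f) := by
  simp [coeffMap, derivative_map]

/-- The tensor density module of weight `m : R` over `R[X]`. -/
def density (m : R) : Vec →ₗ⁅ℂ⁆ Module.End ℂ R[X] where
  toFun D :=
    { toFun := fun g => coeffMap R (D X) * derivative g + C m * coeffMap R (derivative (D X)) * g
      map_add' := fun g h => by simp only [map_add]; ring
      map_smul' := fun c g => by
        simp only [derivative_smul, mul_smul_comm, RingHom.id_apply, smul_add] }
  map_add' D D' := by
    refine LinearMap.ext fun g => ?_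
    simp only [LinearMap.coe_mk, AddHom.coe_mk, LinearMap.add_apply, Derivation.add_apply, map_add]
    ring
  map_smul' c D := by
    refine LinearMap.ext fun g => ?_
    simp only [LinearMap.coe_mk, AddHom.coe_mk, LinearMap.smul_apply, Derivation.smul_apply,
      derivative_smul, map_smul, RingHom.id_apply, smul_add, smul_mul_assoc, mul_smul_comm]
  map_lie' := by
    intro D D'
    refine LinearMap.ext fun g => ?_
    rw [eq_vectorField D, eq_vectorField D']
    generalize D X = f
    generalize D' X = f'
    simp only [LinearMap.coe_mk, AddHom.coe_mk, Derivation.commutator_apply, vectorField_apply,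
      Ring.lie_def, Module.End.mul_apply, LinearMap.sub_apply, derivative_X, mul_one,
      derivative_mul, derivative_add, derivative_sub, derivative_C, map_sub, map_add, map_mul,
      derivative_coeffMap]
    ring

theorem density_vectorField (m : R) (f : ℂ[X]) (g : R[X]) :
    density m (vectorField f) g =
      coeffMap R f * derivative g + C m * coeffMap R (derivative f) * g := by
  simp [density, vectorField_apply]

theorem tensorDensity_eq_density (l : ℂ) : tensorDensity l = density l := by
  refine LieHom.ext fun D => LinearMap.ext fun g => ?_
  rw [eq_vectorField D, tensorDensity_vectorField, density_vectorField, coeffMap_self,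
    coeffMap_self]

/-- The action of the enveloping algebra on the tensor density module of weight `m`. -/
def action (m : R) : U →ₐ[ℂ] Module.End ℂ R[X] := UniversalEnvelopingAlgebra.lift ℂ (density m)

theorem action_F (m : R) (n : ℕ) (g : R[X]) :
    action m (F n) g = X ^ n * derivative g + C m * derivative (X ^ n) * g := by
  rw [action, F, UniversalEnvelopingAlgebra.lift_ι_apply, density_vectorField,
    ← derivative_coeffMap, map_pow, coeffMap_X]

theorem action_algebraMap (m : R) (c : ℂ) (g : R[X]) :
    action m (algebraMap ℂ U c) g = C (algebraMap ℂ R c) * g := by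
  rw [AlgHom.commutes, Module.algebraMap_end_apply, Algebra.smul_def]
  rfl

theorem action_Q (m : R) (g : R[X]) : action m Q g = C (m ^ 2 - m) * g := by
  rw [Q, E_zero, E_one, E_neg_one]
  simp only [map_sub, map_mul, pow_two, LinearMap.sub_apply, Module.End.mul_apply, action_F,
    derivative_mul, derivative_add, derivative_C, derivative_X_pow, derivative_X, map_add,
    pow_one, pow_zero, derivative_one]
  norm_num
  ring

theorem action_Z (m : R) (g : R[X]) : action m Z g = C (m ^ 2 - m) * X * g := by
  have h : action m (E 1 * E 0 - E 2 * E (-1) - E 1) g = (2 : ℂ) • (C (m ^ 2 - m) * X * g) := by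
    rw [E_zero, E_one, E_neg_one, E_two, two_smul]
    simp only [map_sub, map_mul, pow_two, LinearMap.sub_apply, Module.End.mul_apply, action_F,
      derivative_mul, derivative_add, derivative_C, derivative_X_pow, derivative_X, map_add,
      pow_one, pow_zero, derivative_one]
    norm_num
    rw [show (C (3 : R) : R[X]) = 3 from map_ofNat C 3]
    ring
  rw [Z, map_smul, LinearMap.smul_apply, h, smul_smul]
  norm_num

/-- The scalar changes sign under `m ↦ 1 - m`, while that of `Q` is unchanged; this is what makes
`Y` indispensable. -/
theorem action_Y (m : R) (g : R[X]) :
    action m Y g = C ((m - algebraMap ℂ R (1 / 2)) * (m ^ 2 - m)) * g := by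
  rw [Y, E_zero, E_neg_one]
  simp only [map_sub (action m), map_mul (action m), LinearMap.sub_apply, Module.End.mul_apply,
    action_F, action_Q, action_Z, action_algebraMap]
  simp only [pow_one, pow_zero, derivative_X, derivative_one, map_sub, map_mul]
  ring

theorem Q_sub_mem_annihilator (l : ℂ) :
    Q - algebraMap ℂ U (q l) ∈ annihilator (tensorDensity l) := by
  rw [annihilator, TwoSidedIdeal.mem_ker, tensorDensity_eq_density]
  refine LinearMap.ext fun g => ?_
  change action l _ g = 0
  rw [map_sub, LinearMap.sub_apply, action_Q, action_algebraMap, Algebra.algebraMap_self_apply, q,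
    sub_self]

theorem Y_sub_mem_annihilator (l : ℂ) :
    Y - algebraMap ℂ U (y l) ∈ annihilator (tensorDensity l) := by
  rw [annihilator, TwoSidedIdeal.mem_ker, tensorDensity_eq_density]
  refine LinearMap.ext fun g => ?_
  change action l _ g = 0
  rw [map_sub, LinearMap.sub_apply, action_Y, action_algebraMap, Algebra.algebraMap_self_apply,
    Algebra.algebraMap_self_apply, y, q, sub_self]

theorem mem_annihilator_iff (l : ℂ) (u : U) :
    u ∈ annihilator (tensorDensity l) ↔ action l u = 0 := by
  rw [annihilator, TwoSidedIdeal.mem_ker, tensorDensity_eq_density]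
  rfl

end Density

/-! ### The annihilator -/

/-- The operators `g ↦ X ^ i * g⁽ʲ⁾` on `ℂ[X]` are linearly independent. -/
theorem linearIndependent_pow_mul_iterate_derivative (c : ℕ × ℕ →₀ ℂ)
    (h : ∀ g : ℂ[X], (c.sum fun i a => a • (X ^ i.1 * derivative^[i.2] g)) = 0) : c = 0 := by
  -- Evaluated on `X ^ m`, the terms with `j > m` vanish and those with `j < m` are zero by
  -- induction, leaving `m!` times a coefficient.
  have key : ∀ m i, c (i, m) = 0 := by
    intro m
    induction m using Nat.strong_induction_on with
    | _ m ih =>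
      intro i
      have h1 := congrArg (fun p : ℂ[X] => p.coeff i) (h (X ^ m))
      simp only [Finsupp.sum, finsetSum_coeff, coeff_zero, iterate_derivative_X_pow_eq_C_mul,
        coeff_smul, smul_eq_mul] at h1
      rw [Finset.sum_eq_single (i, m)] at h1
      · simpa [Nat.descFactorial_self, Nat.factorial_ne_zero] using h1
      · rintro ⟨i', j⟩ - hne
        rcases lt_trichotomy j m with hj | rfl | hj
        · rw [ih j hj, zero_mul]
        · have : i ≠ i' := fun hi => hne (by rw [hi])
          simp [this, coeff_X_pow]
        · simp [Nat.descFactorial_eq_zero_iff_lt.2 hj]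
      · intro hi
        rw [Finsupp.notMem_support_iff.1 hi, zero_mul]
  ext ⟨i, m⟩
  exact key m i

theorem annihilator_eq_span {l : ℂ} (h0 : l ≠ 0) (h1 : l ≠ 1) :
    annihilator (tensorDensity l) = TwoSidedIdeal.span {Q - algebraMap ℂ U (q l),
      Y - algebraMap ℂ U (y l)} := by
  have hq : q l ≠ 0 := by
    rw [q, show l ^ 2 - l = l * (l - 1) by ring]
    exact mul_ne_zero h0 (sub_ne_zero.2 h1)
  set I := TwoSidedIdeal.span {Q - algebraMap ℂ U (q l), Y - algebraMap ℂ U (y l)} with hI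
  have hle : I ≤ annihilator (tensorDensity l) := by
    rw [hI, TwoSidedIdeal.span_le]
    rintro u (rfl | rfl)
    · exact Q_sub_mem_annihilator l
    · exact Y_sub_mem_annihilator l
  refine le_antisymm (fun u hu => ?_) hle
  let φ : U →ₐ[ℂ] I.ringCon.Quotient := I.ringCon.mkₐ ℂ
  have hφ : Function.Surjective φ := RingCon.mkₐ_surjective _
  have φ_eq : ∀ a b, φ a = φ b ↔ a - b ∈ I := fun a b => by
    rw [← I.rel_iff]
    exact RingCon.eq _
  have hφQ : φ Q = algebraMap ℂ _ (q l) := by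
    rw [← AlgHom.commutes φ, φ_eq]
    exact TwoSidedIdeal.subset_span (by simp)
  have hφY : φ Y = algebraMap ℂ _ (y l) := by
    rw [← AlgHom.commutes φ, φ_eq]
    exact TwoSidedIdeal.subset_span (by simp)
  obtain ⟨c, hc⟩ := Finsupp.mem_span_range_iff_exists_finsupp.1
    (mem_span_of_Q_eq_of_Y_eq h0 h1 hφ hφQ hφY (φ u))
  -- `u'` is a normal form of `u` modulo `I`, so it too annihilates the module; linear independence
  -- then gives `u' = 0`.
  let u' : U := c.sum fun i a => a • (((q l)⁻¹ • Z) ^ i.1 * F 0 ^ i.2)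
  have hu' : φ u = φ u' := by
    rw [← hc, map_finsuppSum]
    simp only [map_smul, map_mul, map_pow]
  rw [φ_eq] at hu'
  have hx : ∀ (n : ℕ) (g : ℂ[X]), (((q l)⁻¹ • action l Z) ^ n) g = X ^ n * g := by
    intro n g
    induction n with
    | zero => simp
    | succ n ih =>
      rw [pow_succ', Module.End.mul_apply, ih, LinearMap.smul_apply, action_Z, ← q,
        mul_assoc, ← smul_eq_C_mul, smul_smul, inv_mul_cancel₀ hq, one_smul]
      ring
  have hd : ∀ (n : ℕ) (g : ℂ[X]), (action l (F 0) ^ n) g = derivative^[n] g := by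
    intro n g
    induction n with
    | zero => simp
    | succ n ih =>
      rw [pow_succ', Module.End.mul_apply, ih, action_F, Function.iterate_succ_apply']
      simp
  have hact : action l u' = 0 := by
    have := (mem_annihilator_iff l _).1 (hle hu')
    rwa [map_sub, (mem_annihilator_iff l u).1 hu, zero_sub, neg_eq_zero] at this
  have hc0 : c = 0 := by
    refine linearIndependent_pow_mul_iterate_derivative c fun g => ?_
    have := LinearMap.congr_fun hact g
    rw [map_finsuppSum] at this
    simp only [map_smul, map_mul, map_pow, Finsupp.sum, LinearMap.sum_apply, LinearMap.smul_apply,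
      Module.End.mul_apply, hx, hd, LinearMap.zero_apply] at this
    exact this
  have : u' = 0 := by simp [u', hc0]
  rwa [this, sub_zero] at hu'

/-! ### Degrees -/

theorem degLE_mono {L : Type*} [LieRing L] [LieAlgebra ℂ L] {j k : ℕ} (h : j ≤ k) :
    degLE (L := L) j ≤ degLE k :=
  Submodule.span_mono fun _ ⟨w, hw, hu⟩ => ⟨w, hw.trans h, hu⟩

theorem idealDegLE_mono {L : Type*} [LieRing L] [LieAlgebra ℂ L]
    (I : TwoSidedIdeal (UniversalEnvelopingAlgebra ℂ L)) {j k : ℕ} (h : j ≤ k) :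
    idealDegLE I j ⊆ idealDegLE I k :=
  fun _ hu => ⟨hu.1, degLE_mono h hu.2⟩

theorem mul_mem_degLE {L : Type*} [LieRing L] [LieAlgebra ℂ L] {j k n : ℕ} (hn : j + k = n)
    {a b : UniversalEnvelopingAlgebra ℂ L} (ha : a ∈ degLE j) (hb : b ∈ degLE k) :
    a * b ∈ degLE n := by
  subst hn
  have := Submodule.mul_mem_mul ha hb
  rw [degLE, degLE, Submodule.span_mul_span] at this
  refine Submodule.span_mono ?_ this
  rintro _ ⟨_, ⟨w, hw, rfl⟩, _, ⟨w', hw', rfl⟩, rfl⟩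
  exact ⟨w ++ w', by simp; omega, by simp⟩

theorem ι_mem_degLE {L : Type*} [LieRing L] [LieAlgebra ℂ L] (D : L) :
    UniversalEnvelopingAlgebra.ι ℂ D ∈ degLE (L := L) 1 :=
  Submodule.subset_span ⟨[D], by simp, by simp⟩

theorem algebraMap_mem_degLE {L : Type*} [LieRing L] [LieAlgebra ℂ L] (c : ℂ) (k : ℕ) :
    algebraMap ℂ _ c ∈ degLE (L := L) k := by
  rw [Algebra.algebraMap_eq_smul_one]
  exact Submodule.smul_mem _ _ (Submodule.subset_span ⟨[], by simp, by simp⟩)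

theorem E_mem_degLE (n : ℤ) : E n ∈ degLE (L := Vec) 1 := ι_mem_degLE _

theorem E_mul_E_mem_degLE (m n : ℤ) : E m * E n ∈ degLE (L := Vec) 2 := by
  have h := mul_mem_degLE (n := 2) rfl (E_mem_degLE m) (E_mem_degLE n)
  exact h

theorem E_mem_degLE_two (n : ℤ) : E n ∈ degLE (L := Vec) 2 :=
  degLE_mono one_le_two (E_mem_degLE n)

theorem Q_mem_degLE : Q ∈ degLE (L := Vec) 2 := by
  rw [Q, pow_two]
  exact Submodule.sub_mem _ (Submodule.sub_mem _ (E_mul_E_mem_degLE 0 0) (E_mem_degLE_two 0))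
    (E_mul_E_mem_degLE 1 (-1))

theorem Z_mem_degLE : Z ∈ degLE (L := Vec) 2 := by
  rw [Z]
  exact Submodule.smul_mem _ _ (Submodule.sub_mem _ (Submodule.sub_mem _ (E_mul_E_mem_degLE 1 0)
    (E_mul_E_mem_degLE 2 (-1))) (E_mem_degLE_two 1))

theorem Y_mem_degLE : Y ∈ degLE (L := Vec) 3 := by
  have h : E 0 - algebraMap ℂ U (1 / 2) ∈ degLE (L := Vec) 1 :=
    Submodule.sub_mem _ (E_mem_degLE 0) (algebraMap_mem_degLE _ 1)
  have h1 := mul_mem_degLE (n := 3) rfl Q_mem_degLE h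
  have h2 := mul_mem_degLE (n := 3) rfl Z_mem_degLE (E_mem_degLE (-1))
  exact Submodule.sub_mem _ h1 h2

/-- Elements of degree at most two act by second order operators whose dependence on the
weight `m` is explicit. -/
theorem exists_action_eq {u : U} (hu : u ∈ degLE 2) :
    ∃ s h r c : ℂ[X], ∀ (R : Type) [CommRing R] [Algebra ℂ R] (m : R) (g : R[X]),
      action m u g = coeffMap R s * derivative (derivative g)
        + (C m * coeffMap R (derivative s) + coeffMap R ((1 / 2 : ℂ) • derivative s + h))
          * derivative g
        + (C m * coeffMap R ((1 / 2 : ℂ) • derivative (derivative s) + derivative h)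
          + C (m ^ 2 - m) * coeffMap R r + coeffMap R c) * g := by
  induction hu using Submodule.span_induction with
  | mem u hu =>
    obtain ⟨w, hw, rfl⟩ := hu
    match w, hw with
    | [], _ => exact ⟨0, 0, 0, 1, fun R _ _ m g => by simp⟩
    | [D], _ =>
      refine ⟨0, D X, 0, 0, fun R _ _ m g => ?_⟩
      rw [List.map_singleton, List.prod_singleton, action,
        UniversalEnvelopingAlgebra.lift_ι_apply, eq_vectorField D, density_vectorField]
      simp [vectorField_apply]
    | [D, D'], _ =>
      obtain ⟨f, rfl⟩ : ∃ f, D = vectorField f := ⟨_, eq_vectorField D⟩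
      obtain ⟨f', rfl⟩ : ∃ f, D' = vectorField f := ⟨_, eq_vectorField D'⟩
      -- The antisymmetric part is chosen so that `f * derivative f'` is half the derivative of the
      -- symbol plus `h`. All terms linear in `m` are then controlled by `s` and `h`.
      refine ⟨f * f', (1 / 2 : ℂ) • (f * derivative f' - f' * derivative f),
        derivative f * derivative f', 0, fun R _ _ m g => ?_⟩
      have e1 : (1 / 2 : ℂ) • derivative (f * f')
          + (1 / 2 : ℂ) • (f * derivative f' - f' * derivative f) = f * derivative f' := by
        rw [derivative_mul, ← smul_add,
          show derivative f * f' + f * derivative f' + (f * derivative f' - f' * derivative f)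
            = (2 : ℂ) • (f * derivative f') by rw [two_smul]; ring, smul_smul]
        norm_num
      have e2 : (1 / 2 : ℂ) • derivative (derivative (f * f'))
          + derivative ((1 / 2 : ℂ) • (f * derivative f' - f' * derivative f)) =
          derivative f * derivative f' + f * derivative (derivative f') := by
        rw [← derivative_smul, ← derivative_add, e1, derivative_mul]
      rw [e1, e2]
      simp only [List.map_cons, List.map_nil, List.prod_cons, List.prod_nil, mul_one, action,
        map_mul (UniversalEnvelopingAlgebra.lift ℂ (density m)), Module.End.mul_apply,
        UniversalEnvelopingAlgebra.lift_ι_apply, density_vectorField, derivative_add,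
        derivative_mul, derivative_C, derivative_coeffMap, map_add, map_mul, map_sub, map_pow,
        map_zero]
      ring
    | _ :: _ :: _ :: _, hw => simp at hw
  | zero => exact ⟨0, 0, 0, 0, fun R _ _ m g => by simp⟩
  | add a b _ _ ha hb =>
    obtain ⟨s, h, r, c, H⟩ := ha
    obtain ⟨s', h', r', c', H'⟩ := hb
    refine ⟨s + s', h + h', r + r', c + c', fun R _ _ m g => ?_⟩
    rw [map_add, LinearMap.add_apply, H, H']
    simp only [derivative_add, smul_add, map_add]
    ring
  | smul k a _ ha =>
    obtain ⟨s, h, r, c, H⟩ := ha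
    refine ⟨k • s, k • h, k • r, k • c, fun R _ _ m g => ?_⟩
    rw [map_smul, LinearMap.smul_apply, H]
    simp only [derivative_smul, smul_add, smul_comm _ k, map_add, map_smul, mul_smul_comm,
      smul_mul_assoc, add_mul, mul_add]

/-- An element of degree at most two which annihilates the tensor density module of weight `l`
annihilates every tensor density module whose weight `m` satisfies `m ^ 2 - m = q l`. -/
theorem action_eq_zero_of_mem_degLE_two {l : ℂ} {u : U} (hu : u ∈ degLE 2) (h : action l u = 0)
    {R : Type} [CommRing R] [Algebra ℂ R] {m : R} (hm : m ^ 2 - m = algebraMap ℂ R (q l)) :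
    action m u = 0 := by
  obtain ⟨s, t, r, c, H⟩ := exists_action_eq hu
  have H0 := fun g => (H ℂ l g).symm.trans (LinearMap.congr_fun h g)
  simp only [coeffMap_self, LinearMap.zero_apply] at H0
  -- The tests `1`, `X`, `X ^ 2` isolate the coefficients of orders zero, one and two. With `s = t =
  -- 0`, only `q l` and not `l` itself survives.
  have h1 := H0 1
  simp only [derivative_one, map_zero, mul_zero, zero_add, mul_one] at h1
  have hX := H0 X
  simp only [derivative_X, derivative_one, mul_zero, zero_add, mul_one, h1, zero_mul,
    add_zero] at hX
  have hX2 := H0 (X ^ 2)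
  have hs : s = 0 := by
    rw [h1, hX] at hX2
    simpa using hX2
  subst hs
  have ht : t = 0 := by simpa using hX
  subst ht
  have hr : C (l ^ 2 - l) * r + c = 0 := by simpa using h1
  refine LinearMap.ext fun g => ?_
  rw [H, hm]
  have := congrArg (coeffMap R) hr
  rw [map_add, map_mul, coeffMap_C, map_zero, ← q] at this
  simp [this]

theorem eq_zero_of_mem_degLE_one {l : ℂ} {u : U} (hu : u ∈ degLE 1) (h : action l u = 0) :
    u = 0 := by
  have hform : ∃ (c : ℂ) (D : Vec), u = algebraMap ℂ U c + UniversalEnvelopingAlgebra.ι ℂ D := by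
    clear h
    induction hu using Submodule.span_induction with
    | mem u hu =>
      obtain ⟨w, hw, rfl⟩ := hu
      match w, hw with
      | [], _ => exact ⟨1, 0, by simp⟩
      | [D], _ => exact ⟨0, D, by simp⟩
      | _ :: _ :: _, hw => simp at hw
    | zero => exact ⟨0, 0, by simp⟩
    | add a b _ _ ha hb =>
      obtain ⟨c, D, rfl⟩ := ha
      obtain ⟨c', D', rfl⟩ := hb
      exact ⟨c + c', D + D', by simp only [map_add]; abel⟩
    | smul k a _ ha =>
      obtain ⟨c, D, rfl⟩ := ha
      exact ⟨k * c, k • D, by rw [smul_add, map_smul, map_mul, Algebra.smul_def]⟩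
  obtain ⟨c, D, rfl⟩ := hform
  obtain ⟨f, rfl⟩ : ∃ f, D = vectorField f := ⟨_, eq_vectorField D⟩
  have H : ∀ g : ℂ[X], C c * g + (f * derivative g + C l * derivative f * g) = 0 := fun g => by
    have := LinearMap.congr_fun h g
    rw [map_add, LinearMap.add_apply, action_algebraMap, action,
      UniversalEnvelopingAlgebra.lift_ι_apply, ← tensorDensity_eq_density,
      tensorDensity_vectorField] at this
    exact this
  have h1 := H 1
  have hX := H X
  simp only [derivative_one, derivative_X, mul_one, mul_zero, zero_add] at h1 hX
  have hf : f = 0 := by linear_combination hX - X * h1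
  subst hf
  have hc : c = 0 := by simpa using h1
  subst hc
  simp [← vectorFieldₗ_apply]

/-- The natural second weight is `1 - l`, but it coincides with `l` when `l = 1 / 2`. Taking `m` to
be the class of `X` in `ℂ[X] / (X² - X - q l)` treats all cases at once: this algebra has dimension
two, so `m ≠ l` even at a double root. -/
theorem Y_sub_notMem_span {l : ℂ} (h0 : l ≠ 0) (h1 : l ≠ 1) :
    Y - algebraMap ℂ U (y l) ∉
      TwoSidedIdeal.span (idealDegLE (annihilator (tensorDensity l)) 2) := by
  intro hmem
  have hq : q l ≠ 0 := by
    rw [q, show l ^ 2 - l = l * (l - 1) by ring]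
    exact mul_ne_zero h0 (sub_ne_zero.2 h1)
  let P : ℂ[X] := X ^ 2 - X - C (q l)
  have hP : P.Monic := by unfold P; monicity!
  have hdeg : P.natDegree = 2 := by unfold P; compute_degree!
  let m : AdjoinRoot P := AdjoinRoot.root P
  have hm : m ^ 2 - m = algebraMap ℂ (AdjoinRoot P) (q l) := by
    have := AdjoinRoot.eval₂_root P
    simp only [P, eval₂_sub, eval₂_pow, eval₂_X, eval₂_C] at this
    exact sub_eq_zero.1 this
  have hle : TwoSidedIdeal.span (idealDegLE (annihilator (tensorDensity l)) 2) ≤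
      TwoSidedIdeal.ker (action m) := by
    rw [TwoSidedIdeal.span_le]
    rintro u ⟨hu, hu2⟩
    exact (TwoSidedIdeal.mem_ker _).2
      (action_eq_zero_of_mem_degLE_two hu2 ((mem_annihilator_iff l u).1 hu) hm)
  have hY := LinearMap.congr_fun ((TwoSidedIdeal.mem_ker _).1 (hle hmem)) 1
  rw [map_sub, LinearMap.sub_apply, action_Y, action_algebraMap, hm, mul_one, mul_one, ← C_sub,
    LinearMap.zero_apply, C_eq_zero, y, map_mul, ← sub_mul, map_sub, sub_sub_sub_cancel_right,
    mul_comm, ← Algebra.smul_def] at hY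
  have hml := (smul_eq_zero.1 hY).resolve_left hq
  -- `X - l` has degree less than `P`, so `m - l` cannot vanish.
  refine AdjoinRoot.mk_ne_zero_of_natDegree_lt hP (X_sub_C_ne_zero l) ?_ ?_
  · rw [hdeg, natDegree_X_sub_C]
    norm_num
  · rw [map_sub, AdjoinRoot.mk_X, AdjoinRoot.mk_C]
    exact hml

end
end VecR

/-! ### The main theorem -/

theorem mainTheorem1 (l : ℂ) (h0 : l ≠ 0) (h1 : l ≠ 1) :
    VecR.annihilator (VecR.tensorDensity l) =
        TwoSidedIdeal.span {VecR.Q - algebraMap ℂ VecR.U (VecR.q l),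
          VecR.Y - algebraMap ℂ VecR.U (VecR.y l)} ∧
      VecR.IsGeneratedInDegrees ![2, 3] (VecR.annihilator (VecR.tensorDensity l)) ∧
      ¬ VecR.IsGeneratedInDegrees ![2] (VecR.annihilator (VecR.tensorDensity l)) := by
  have hY := VecR.Y_sub_notMem_span h0 h1
  refine ⟨VecR.annihilator_eq_span h0 h1, ⟨?_, ?_, ?_, ?_, ?_⟩, ?_⟩
  · intro i j hij
    fin_cases i <;> fin_cases j <;> simp_all
  · intro k hk
    refine Set.eq_singleton_iff_unique_mem.2 ⟨⟨zero_mem _, zero_mem _⟩, fun u hu => ?_⟩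
    have hk' : k ≤ 1 := Nat.lt_succ_iff.1 hk
    exact VecR.eq_zero_of_mem_degLE_one (VecR.degLE_mono hk' hu.2)
      ((VecR.mem_annihilator_iff l u).1 hu.1)
  · intro s k hk u hu
    fin_cases s
    have hk' : k ≤ 2 := Nat.lt_succ_iff.1 hk
    exact TwoSidedIdeal.subset_span (VecR.idealDegLE_mono _ hk' hu)
  · intro s hs
    fin_cases s
    exact hY (hs _ ⟨VecR.Y_sub_mem_annihilator l,
      Submodule.sub_mem _ VecR.Y_mem_degLE (VecR.algebraMap_mem_degLE _ _)⟩)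
  · refine le_antisymm (TwoSidedIdeal.span_le.2 fun u hu => hu.1) ?_
    conv_lhs => rw [VecR.annihilator_eq_span h0 h1]
    refine TwoSidedIdeal.span_mono ?_
    rintro u (rfl | rfl)
    · exact ⟨VecR.Q_sub_mem_annihilator l, Submodule.sub_mem _
        (VecR.degLE_mono (show 2 ≤ 3 by norm_num) VecR.Q_mem_degLE) (VecR.algebraMap_mem_degLE _ _)⟩
    · exact ⟨VecR.Y_sub_mem_annihilator l,
        Submodule.sub_mem _ VecR.Y_mem_degLE (VecR.algebraMap_mem_degLE _ _)⟩
  · intro h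
    refine hY ?_
    have := h.span_eq
    change TwoSidedIdeal.span (VecR.idealDegLE _ 2) = _ at this
    rw [this]
    exact VecR.Y_sub_mem_annihilator l
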